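/- For a finite simple graph $G$, let $\mathrm{Ind}(G)$ be its independence complex, the simplicial complex whose vertices are the vertices of $G$ and whose simplices are the independent sets of $G$, and let $\Sigma$ denote unreduced suspension. For $m\ge 3$ let $C_m^r$ be the $r$-th distance power of the $m$-cycle: its vertices are those of the cycle, and two distinct vertices are adjacent if and only if their distance along the cycle is at most $r$. Let $r\ge 1$ and $n\ge 5r+4$, and label the vertices of the $n$-cycle cyclically by the elements of $\mathbb{Z}/n$. Let $\overline{C_n^r}$ be the graph on the same vertices obtained from $C_n^r$ by adding the following edges (labels are read modulo $n$): - First phase: for each $s=1,\ldots,r-1$, the edges $(i,\,i+2r-s+2)$ for $i=1,\ldots,r+s+1$ and the edges $(i,\,i+3r-s+3)$ for $i=1,\ldots,s$. - Second phase: the edges $(-x,\,3r+3+y)$ for all integers $0\le x\le r-1$, $1\le y\le r$ with $x+y\le r$. Then there is a homotopy equivalence $$\mathrm{Ind}(\overline{C_n^r})\simeq\Sigma^2\,\mathrm{Ind}(C_{n-(3r+3)}^r).$$ -/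

import Mathlib

open scoped unitInterval

/-- The independence complex `Ind(G)`: its vertices are the vertices of `G`, and its simplices are
the nonempty finite independent sets of `G`. -/
def independenceComplex {V : Type*} (G : SimpleGraph V) : AbstractSimplicialComplex V where
  faces := {s | s.Nonempty ∧ G.IsIndepSet (s : Set V)}
  isRelLowerSet_faces := fun _ hs =>
    ⟨hs.1, fun _ hts ht => ⟨ht, hs.2.mono (Finset.coe_subset.mpr hts)⟩⟩
  singleton_mem := fun v => ⟨Finset.singleton_nonempty v, by simp [SimpleGraph.IsIndepSet]⟩

/-- The geometric realization `|K|` of a simplicial complex on a finite vertex set `V`: the union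
of the faces of the standard simplex on `V` spanned by the simplices of `K`, that is, the set of
all barycentric coordinate vectors supported on a simplex of `K`. It carries the subspace topology
from `V → ℝ`. -/
def geomRealization {V : Type*} [Fintype V] (K : AbstractSimplicialComplex V) : Set (V → ℝ) :=
  {x | x ∈ stdSimplex ℝ V ∧ ∃ s ∈ K.faces, ∀ v, v ∉ s → x v = 0}

/-- The gluing relation of the unreduced suspension: the end `X × {0}` of the cylinder is collapsed
to the pole `false` and the end `X × {1}` to the pole `true`. -/
inductive SuspensionRel (X : Type*) : (X × I) ⊕ Bool → (X × I) ⊕ Bool → Prop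
  | bottom (x : X) : SuspensionRel X (Sum.inl (x, 0)) (Sum.inr false)
  | top (x : X) : SuspensionRel X (Sum.inl (x, 1)) (Sum.inr true)

/-- The unreduced suspension `ΣX`. The two poles are present even for empty `X`, so that the
suspension of the empty space is the two-point space `S⁰`. -/
def Suspension (X : Type*) : Type _ := Quot (SuspensionRel X)

/-- The suspension carries the quotient topology. -/
instance Suspension.instTopologicalSpace (X : Type*) [TopologicalSpace X] :
    TopologicalSpace (Suspension X) :=
  inferInstanceAs (TopologicalSpace (Quot (SuspensionRel X)))

/-- The `r`-th distance power `G^r`: two distinct vertices are adjacent if and only if their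
distance in `G` is at most `r`. -/
def distancePower {V : Type*} (G : SimpleGraph V) (r : ℕ) : SimpleGraph V where
  Adj u v := u ≠ v ∧ G.edist u v ≤ r
  symm := ⟨fun u v h => ⟨h.1.symm, by rw [SimpleGraph.edist_comm]; exact h.2⟩⟩
  loopless := ⟨fun _ h => h.1 rfl⟩

/-- The `r`-th power `C_n^r` of the cycle with `n` vertices (the empty graph for `n = 0`). -/
def cyclePower (n r : ℕ) : SimpleGraph (Fin n) :=
  distancePower (SimpleGraph.cycleGraph n) r

/-- The edges `(a, b)` (as pairs of integer labels) added in stage `s` of the first phase: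
the first group `(i, i + 2r - s + 2)` for `i = 1, …, r + s + 1`, and
the second group `(i, i + 3r - s + 3)` for `i = 1, …, s`. -/
def FirstPhaseStage (r s a b : ℤ) : Prop :=
  (∃ i : ℤ, 1 ≤ i ∧ i ≤ r + s + 1 ∧ a = i ∧ b = i + 2 * r - s + 2) ∨
  (∃ i : ℤ, 1 ≤ i ∧ i ≤ s ∧ a = i ∧ b = i + 3 * r - s + 3)

/-- The edges added in the first phase, which has the stages `s = 1, …, r - 1`. -/
def FirstPhase (r a b : ℤ) : Prop :=
  ∃ s : ℤ, 1 ≤ s ∧ s ≤ r - 1 ∧ FirstPhaseStage r s a b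

/-- The edges added in the second phase: `(-x, 3r + 3 + y)` for `0 ≤ x ≤ r - 1`, `1 ≤ y ≤ r`,
`x + y ≤ r`. -/
def SecondPhase (r a b : ℤ) : Prop :=
  ∃ x y : ℤ, 0 ≤ x ∧ x ≤ r - 1 ∧ 1 ≤ y ∧ y ≤ r ∧ x + y ≤ r ∧ a = -x ∧ b = 3 * r + 3 + y

/-- The extended graph: `C_n^r` together with all edges of the first and the second phase, where
integer labels of vertices are read modulo `n`. -/
def extendedCyclePower (n r : ℕ) : SimpleGraph (Fin n) :=
  cyclePower n r ⊔ SimpleGraph.fromRel (fun u v : Fin n =>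
    ∃ a b : ℤ, (FirstPhase r a b ∨ SecondPhase r a b) ∧
      ((u : ℕ) : ℤ) ≡ a [ZMOD n] ∧ ((v : ℕ) : ℤ) ≡ b [ZMOD n])

/-! Both independence complexes are clique complexes of non-adjacency relations, and all work is
done with such relations. Two moves change a relation without changing the homotopy type of its
clique complex. A fold (`nonempty_homotopyEquiv_of_contiguous`) replaces vertices by dominating
ones. An exchange (`nonempty_homotopyEquiv_of_exchange`) inserts related pairs whose common link is
a cone, provided no clique contains two of them.

Put `N = n - (3r+3)`. Among the labels `1, …, 3r+3`, the first phase leaves exactly the differences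
`r+1, r+2, 2r+2, 2r+3` non-adjacent; cut into three blocks of length `r+1` (left, middle, right),
these labels form a triangulated strip. The second phase closes up the remaining `N` outer labels
into a copy of `C_N^r`. If every strip vertex were related to every outer vertex, the complex would
be the join of the strip with `Ind(C_N^r)`. Only some left-outer and right-outer pairs are missing.

For `r ≥ 2`, exchanges supply them. The cone condition for left-outer pairs needs consecutive right
vertices to be related, and that for right-outer pairs needs consecutive left vertices to be
related; these auxiliary pairs are inserted by exchanges of their own. The strip then folds onto a
cycle of length `r+2`, which shortens to a 4-cycle. For `r = 1` the auxiliary pairs are not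
available, and two middle-outer pairs are removed instead (`homotopyEquiv_middleOuter_one`). In both
cases the result is the join of a 4-cycle with `Ind(C_N^r)`. A 4-cycle is the join of two copies of
`S⁰`, so this is a double suspension (`homotopyEquiv_cycleJoin_four`, `suspensionHomeomorph`). -/

/-! ### Clique complexes of relations, straight-line homotopies and folds. -/

section CliqueSpace

variable {V W : Type*} [Fintype V]

/-- The geometric realization of the clique complex of a relation `R`: the points of the standard
simplex whose support is a clique of `R`. Vertices `v` with `¬ R v v` do not belong to it. -/
def cliqueSpace (R : V → V → Prop) : Set (V → ℝ) :=
  {x | x ∈ stdSimplex ℝ V ∧ ∀ u v, x u ≠ 0 → x v ≠ 0 → R u v}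

theorem geomRealization_independenceComplex (G : SimpleGraph V) :
    geomRealization (independenceComplex G) = cliqueSpace fun u v => ¬ G.Adj u v := by
  classical
  ext x
  constructor
  · rintro ⟨hx, s, hs, hsx⟩
    refine ⟨hx, fun u v hu hv hadj => ?_⟩
    have hu' : u ∈ s := by_contra fun h => hu (hsx u h)
    have hv' : v ∈ s := by_contra fun h => hv (hsx v h)
    exact hs.2 hu' hv' hadj.ne hadj
  · rintro ⟨hx, h⟩
    refine ⟨hx, Finset.univ.filter fun v => x v ≠ 0, ⟨?_, ?_⟩, fun v hv => by simpa using hv⟩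
    · by_contra hne
      rw [Finset.not_nonempty_iff_eq_empty, Finset.filter_eq_empty_iff] at hne
      have h0 : ∑ v, x v = 0 := Finset.sum_eq_zero fun v hv => by simpa using hne hv
      rw [hx.2] at h0
      exact one_ne_zero h0
    · intro u hu v hv _
      exact h u v (by simpa using hu) (by simpa using hv)

/-- Two maps into a clique space are homotopic along straight lines if the union of the supports
of their values at each point is a clique. -/
theorem homotopic_of_support {X : Type*} [TopologicalSpace X] {R : V → V → Prop}
    (f g : C(X, cliqueSpace R))
    (h : ∀ x u v, ((f x).1 u ≠ 0 ∨ (g x).1 u ≠ 0) → ((f x).1 v ≠ 0 ∨ (g x).1 v ≠ 0) → R u v) :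
    f.Homotopic g := by
  refine ⟨⟨⟨fun p => ⟨fun v => (1 - (p.1 : ℝ)) * (f p.2).1 v + p.1 * (g p.2).1 v, ?_, ?_⟩, ?_⟩,
    fun x => ?_, fun x => ?_⟩⟩
  · refine ⟨fun v => ?_, ?_⟩
    · have h1 := (f p.2).2.1.1 v
      have h2 := (g p.2).2.1.1 v
      have h3 := p.1.2.1
      have h4 : (0 : ℝ) ≤ 1 - p.1 := sub_nonneg.mpr p.1.2.2
      positivity
    · rw [Finset.sum_add_distrib, ← Finset.mul_sum, ← Finset.mul_sum, (f p.2).2.1.2,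
        (g p.2).2.1.2]
      ring
  · intro u v hu hv
    refine h p.2 u v ?_ ?_
    · by_contra! hc
      exact hu (by simp [hc.1, hc.2])
    · by_contra! hc
      exact hv (by simp [hc.1, hc.2])
  · refine Continuous.subtype_mk (continuous_pi fun v => ?_) _
    have hf : Continuous fun p : I × X => (f p.2).1 v :=
      (continuous_apply v).comp (continuous_subtype_val.comp (f.continuous.comp continuous_snd))
    have hg : Continuous fun p : I × X => (g p.2).1 v :=
      (continuous_apply v).comp (continuous_subtype_val.comp (g.continuous.comp continuous_snd))
    have hp : Continuous fun p : I × X => (p.1 : ℝ) := continuous_subtype_val.comp continuous_fst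
    exact ((continuous_const.sub hp).mul hf).add (hp.mul hg)
  · ext v
    simp
  · ext v
    simp

open Classical in
/-- The linear extension of a map of vertices. -/
noncomputable def pushWeights (φ : V → W) (x : V → ℝ) (w : W) : ℝ :=
  ∑ v, if φ v = w then x v else 0

theorem exists_of_pushWeights_ne_zero {φ : V → W} {x : V → ℝ} {w : W}
    (h : pushWeights φ x w ≠ 0) : ∃ v, φ v = w ∧ x v ≠ 0 := by
  obtain ⟨v, -, hv⟩ := Finset.exists_ne_zero_of_sum_ne_zero h
  by_cases hw : φ v = w
  · exact ⟨v, hw, by simpa [hw] using hv⟩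
  · simp [hw] at hv

variable [Fintype W]

/-- The map of clique spaces induced by a map of vertices that preserves the relations. -/
noncomputable def cliqueMap {R : V → V → Prop} {S : W → W → Prop} (φ : V → W)
    (hφ : ∀ u v, R u v → S (φ u) (φ v)) : C(cliqueSpace R, cliqueSpace S) where
  toFun x := ⟨pushWeights φ x.1, ⟨⟨fun w => by
      classical
      exact Finset.sum_nonneg fun v _ => by split_ifs <;> [exact x.2.1.1 v; exact le_rfl], by
      classical
      simp only [pushWeights]
      rw [Finset.sum_comm]
      simpa using x.2.1.2⟩, by
      intro u v hu hv
      obtain ⟨u', rfl, hu'⟩ := exists_of_pushWeights_ne_zero hu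
      obtain ⟨v', rfl, hv'⟩ := exists_of_pushWeights_ne_zero hv
      exact hφ u' v' (x.2.2 u' v' hu' hv')⟩⟩
  continuous_toFun := by
    refine Continuous.subtype_mk (continuous_pi fun w => continuous_finsetSum _ fun v _ => ?_) _
    by_cases hw : φ v = w
    · simp only [hw, if_true]
      exact (continuous_apply v).comp continuous_subtype_val
    · simpa [hw] using continuous_const

theorem exists_of_cliqueMap_ne_zero {R : V → V → Prop} {S : W → W → Prop} {φ : V → W}
    (hφ : ∀ u v, R u v → S (φ u) (φ v)) {x : cliqueSpace R} {w : W}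
    (h : (cliqueMap φ hφ x).1 w ≠ 0) : ∃ v, φ v = w ∧ x.1 v ≠ 0 :=
  exists_of_pushWeights_ne_zero h

/-- Adjoining `ψ (φ v)` for every vertex `v` of a clique again gives a clique, so the straight line
from a point to its image stays inside one simplex. -/
theorem cliqueMap_comp_homotopic_id {R : V → V → Prop} {S : W → W → Prop} {φ : V → W} {ψ : W → V}
    (hφ : ∀ u v, R u v → S (φ u) (φ v)) (hψ : ∀ u v, S u v → R (ψ u) (ψ v))
    (h : ∀ u v, R u v → R u (ψ (φ v)) ∧ R (ψ (φ v)) u) :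
    ((cliqueMap ψ hψ).comp (cliqueMap φ hφ)).Homotopic (ContinuousMap.id (cliqueSpace R)) := by
  apply homotopic_of_support
  intro x u v hu hv
  have key : ∀ w, ((cliqueMap ψ hψ) (cliqueMap φ hφ x)).1 w ≠ 0 →
      ∃ w', ψ (φ w') = w ∧ x.1 w' ≠ 0 := by
    intro w hw
    obtain ⟨a, rfl, ha⟩ := exists_of_cliqueMap_ne_zero hψ hw
    obtain ⟨b, rfl, hb⟩ := exists_of_cliqueMap_ne_zero hφ ha
    exact ⟨b, rfl, hb⟩
  rcases hu with hu | hu <;> rcases hv with hv | hv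
  · obtain ⟨u', rfl, hu'⟩ := key _ hu
    obtain ⟨v', rfl, hv'⟩ := key _ hv
    exact hψ _ _ (hφ _ _ (x.2.2 u' v' hu' hv'))
  · obtain ⟨u', rfl, hu'⟩ := key _ hu
    exact (h v u' (x.2.2 v u' hv hu')).2
  · obtain ⟨v', rfl, hv'⟩ := key _ hv
    exact (h u v' (x.2.2 u v' hu hv')).1
  · exact x.2.2 u v hu hv

/-- Maps of vertices in both directions induce a homotopy equivalence of clique spaces if both
composites are contiguous to the identity. -/
theorem nonempty_homotopyEquiv_of_contiguous {R : V → V → Prop} {S : W → W → Prop}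
    (hRsymm : ∀ u v, R u v → R v u) (hSsymm : ∀ u v, S u v → S v u) (φ : V → W) (ψ : W → V)
    (hφ : ∀ u v, R u v → S (φ u) (φ v)) (hψ : ∀ u v, S u v → R (ψ u) (ψ v))
    (hR : ∀ u v, R u v → R u (ψ (φ v))) (hS : ∀ u v, S u v → S u (φ (ψ v))) :
    Nonempty (ContinuousMap.HomotopyEquiv (cliqueSpace R) (cliqueSpace S)) :=
  ⟨⟨cliqueMap φ hφ, cliqueMap ψ hψ,
    cliqueMap_comp_homotopic_id hφ hψ fun u v h => ⟨hR u v h, hRsymm _ _ (hR u v h)⟩,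
    cliqueMap_comp_homotopic_id hψ hφ fun u v h => ⟨hS u v h, hSsymm _ _ (hS u v h)⟩⟩⟩

end CliqueSpace

/-! ### Inserting edges whose common link is a cone. -/

section Exchange

variable {V : Type*} [Fintype V]

open Classical in
/-- Move weight from the endpoints of the edges in `E` to their apices until each edge loses one of
its endpoints. -/
noncomputable def pushOff (E : V → V → Prop) (a : V → V → V) (x : V → ℝ) (k : V) : ℝ :=
  x k + ∑ p : V × V, if E p.1 p.2 then min (x p.1) (x p.2) *
    (2 * (if k = a p.1 p.2 then 1 else 0) - (if k = p.1 then 1 else 0) - (if k = p.2 then 1 else 0)) else 0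

theorem continuous_pushOff (E : V → V → Prop) (a : V → V → V) : Continuous (pushOff E a) := by
  classical
  refine continuous_pi fun k => ?_
  refine Continuous.add (continuous_apply k) (continuous_finsetSum _ fun p _ => ?_)
  by_cases h : E p.1 p.2
  · simp only [h, if_true]
    exact ((continuous_apply p.1).min (continuous_apply p.2)).mul continuous_const
  · simpa [h] using continuous_const

theorem sum_pushOff (E : V → V → Prop) (a : V → V → V) (x : V → ℝ) :
    ∑ k, pushOff E a x k = ∑ k, x k := by
  classical
  simp only [pushOff, Finset.sum_add_distrib]
  rw [Finset.sum_comm, add_eq_left]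
  refine Finset.sum_eq_zero fun p _ => ?_
  split_ifs
  · rw [← Finset.mul_sum, Finset.sum_sub_distrib, Finset.sum_sub_distrib, ← Finset.mul_sum]
    simp only [Finset.sum_ite_eq', Finset.mem_univ, if_true]
    norm_num
  · simp

theorem pushOff_eq_self {E : V → V → Prop} {a : V → V → V} {x : V → ℝ} (hx : ∀ v, 0 ≤ x v)
    (h : ∀ u v, E u v → x u = 0 ∨ x v = 0) : pushOff E a x = x := by
  classical
  funext k
  rw [pushOff, add_eq_left]
  refine Finset.sum_eq_zero fun p _ => ?_
  by_cases hp : E p.1 p.2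
  · rw [if_pos hp]
    rcases h _ _ hp with h0 | h0
    · rw [h0, min_eq_left (hx _), zero_mul]
    · rw [h0, min_eq_right (hx _), zero_mul]
  · rw [if_neg hp]

-- The minimum of two endpoint weights vanishes unless both endpoints lie in the support, so only
-- one summand survives.
open Classical in
theorem pushOff_eq_of_unique {E : V → V → Prop} {a : V → V → V} {x : V → ℝ} (hx : ∀ v, 0 ≤ x v)
    {u v : V} (huv : E u v)
    (h : ∀ u' v', E u' v' → x u' ≠ 0 → x v' ≠ 0 → u' = u ∧ v' = v) (k : V) :
    pushOff E a x k = x k + min (x u) (x v) *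
      (2 * (if k = a u v then 1 else 0) - (if k = u then 1 else 0) - (if k = v then 1 else 0)) := by
  classical
  rw [pushOff, add_right_inj, Finset.sum_eq_single (u, v)]
  · simp only [huv, if_true]
  · rintro ⟨p, q⟩ - hpq
    by_cases hE : E p q
    · rw [if_pos hE]
      dsimp only
      by_cases hp : x p = 0
      · rw [hp, min_eq_left (hx _), zero_mul]
      by_cases hq : x q = 0
      · rw [hq, min_eq_right (hx _), zero_mul]
      obtain ⟨rfl, rfl⟩ := h p q hE hp hq
      exact absurd rfl hpq
    · rw [if_neg hE]
  · simp

/-- Edges `E` can be added to the relation `R` without changing the homotopy type of the clique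
space if no clique contains two of them and the common link of the endpoints of each of them is
a cone. -/
theorem nonempty_homotopyEquiv_of_exchange {R R' : V → V → Prop} (E : V → V → Prop)
    (hsymm : ∀ u v, R u v → R v u) (hle : ∀ u v, R u v → R' u v)
    (hR' : ∀ u v, R' u v → R u v ∨ E u v ∨ E v u)
    (hER : ∀ u v, E u v → ¬ R u v)
    (hne : ∀ u v, E u v → u ≠ v)
    (huniq : ∀ u v u' v', E u v → E u' v' → R' u u' → R' u v' → R' v u' → R' v v' →
      u' = u ∧ v' = v)
    (hapex : ∀ u v, E u v → ∃ a, R a a ∧ R a u ∧ R a v ∧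
      ∀ z, R' u z → R' v z → z ≠ u → z ≠ v → R a z) :
    Nonempty (ContinuousMap.HomotopyEquiv (cliqueSpace R) (cliqueSpace R')) := by
  have hex : ∀ u v, ∃ a, E u v → R a a ∧ R a u ∧ R a v ∧
      ∀ z, R' u z → R' v z → z ≠ u → z ≠ v → R a z := fun u v => by
    by_cases h : E u v
    · exact (hapex u v h).imp fun _ ha _ => ha
    · exact ⟨u, fun h' => absurd h' h⟩
  choose a ha using hex
  have happ : ∀ u v, E u v → R (a u v) (a u v) ∧ R (a u v) u ∧ R (a u v) v :=
    fun u v h => ⟨(ha u v h).1, (ha u v h).2.1, (ha u v h).2.2.1⟩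
  have hcone : ∀ u v z, E u v → R' u z → R' v z → z ≠ u → z ≠ v → R (a u v) z :=
    fun u v z h => (ha u v h).2.2.2 z
  classical
  have hau : ∀ u v, E u v → a u v ≠ u := fun u v h h' => hER u v h (h' ▸ (happ u v h).2.2)
  have hav : ∀ u v, E u v → a u v ≠ v := fun u v h h' =>
    hER u v h (hsymm _ _ (by have := (happ u v h).2.1; rwa [h'] at this))
  -- the dichotomy for points of the larger space
  have hcases : ∀ x ∈ cliqueSpace R', (∀ u v, E u v → x u = 0 ∨ x v = 0) ∨
      ∃ u v, E u v ∧ x u ≠ 0 ∧ x v ≠ 0 ∧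
        ∀ u' v', E u' v' → x u' ≠ 0 → x v' ≠ 0 → u' = u ∧ v' = v := by
    intro x hx
    by_cases h : ∀ u v, E u v → x u = 0 ∨ x v = 0
    · exact Or.inl h
    · push Not at h
      obtain ⟨u, v, huv, hu, hv⟩ := h
      exact Or.inr ⟨u, v, huv, hu, hv, fun u' v' h' hu' hv' =>
        huniq u v u' v' huv h' (hx.2 _ _ hu hu') (hx.2 _ _ hu hv') (hx.2 _ _ hv hu')
          (hx.2 _ _ hv hv')⟩
  have hmem : ∀ x ∈ cliqueSpace R', pushOff E a x ∈ cliqueSpace R := by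
    intro x hx
    rcases hcases x hx with h | ⟨u, v, huv, hu, hv, huq⟩
    · rw [pushOff_eq_self hx.1.1 h]
      refine ⟨hx.1, fun u v hu hv => ?_⟩
      rcases hR' u v (hx.2 u v hu hv) with h1 | h1 | h1
      · exact h1
      · rcases h _ _ h1 with h2 | h2
        · exact absurd h2 hu
        · exact absurd h2 hv
      · rcases h _ _ h1 with h2 | h2
        · exact absurd h2 hv
        · exact absurd h2 hu
    · have hval := pushOff_eq_of_unique (a := a) hx.1.1 huv huq
      have h1 := hau u v huv
      have h2 := hav u v huv
      have h3 := hne u v huv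
      have hupos := hx.1.1 u
      have hvpos := hx.1.1 v
      have hvu : pushOff E a x u = x u - min (x u) (x v) := by
        rw [hval]; simp [h1.symm, h3]; ring
      have hvv : pushOff E a x v = x v - min (x u) (x v) := by
        rw [hval]; simp [h2.symm, h3.symm]; ring
      have hva : pushOff E a x (a u v) = x (a u v) + 2 * min (x u) (x v) := by
        rw [hval]; simp [h1, h2]; ring
      have hvo : ∀ k, k ≠ u → k ≠ v → k ≠ a u v → pushOff E a x k = x k := by
        intro k hk1 hk2 hk3
        rw [hval]; simp [hk1, hk2, hk3]
      have hsupp : ∀ k, pushOff E a x k ≠ 0 → k = a u v ∨ x k ≠ 0 := by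
        intro k hk
        by_cases hka : k = a u v
        · exact Or.inl hka
        right
        intro hk0
        have hku : k ≠ u := fun h => hu (h ▸ hk0)
        have hkv : k ≠ v := fun h => hv (h ▸ hk0)
        exact hk (by rw [hvo k hku hkv hka, hk0])
      -- The minimum is attained at one of the endpoints, so the only `E`-edge leaves the support;
      -- all other pairs in it are already related by `R`.
      have hlost : pushOff E a x u = 0 ∨ pushOff E a x v = 0 := by
        rw [hvu, hvv]
        rcases le_total (x u) (x v) with h | h
        · left; rw [min_eq_left h, sub_self]
        · right; rw [min_eq_right h, sub_self]
      have hstar : ∀ k, x k ≠ 0 → R (a u v) k := by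
        intro k hk
        by_cases hku : k = u
        · exact hku ▸ (happ u v huv).2.1
        by_cases hkv : k = v
        · exact hkv ▸ (happ u v huv).2.2
        exact hcone u v k huv (hx.2 _ _ hu hk) (hx.2 _ _ hv hk) hku hkv
      refine ⟨⟨fun k => ?_, by rw [sum_pushOff]; exact hx.1.2⟩, fun p q hp hq => ?_⟩
      · by_cases hku : k = u
        · rw [hku, hvu]; exact sub_nonneg.mpr (min_le_left _ _)
        by_cases hkv : k = v
        · rw [hkv, hvv]; exact sub_nonneg.mpr (min_le_right _ _)
        by_cases hka : k = a u v
        · rw [hka, hva]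
          have := hx.1.1 (a u v)
          positivity
        · rw [hvo k hku hkv hka]; exact hx.1.1 k
      · rcases hsupp p hp with hpa | hp' <;> rcases hsupp q hq with hqa | hq'
        · rw [hpa, hqa]; exact (happ u v huv).1
        · rw [hpa]; exact hstar q hq'
        · rw [hqa]; exact hsymm _ _ (hstar p hp')
        · rcases hR' p q (hx.2 p q hp' hq') with h | h | h
          · exact h
          · obtain ⟨rfl, rfl⟩ := huq p q h hp' hq'
            rcases hlost with h0 | h0
            · exact absurd h0 hp
            · exact absurd h0 hq
          · obtain ⟨rfl, rfl⟩ := huq q p h hq' hp'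
            rcases hlost with h0 | h0
            · exact absurd h0 hq
            · exact absurd h0 hp
  -- The support of `x` together with that of its push-off lies in the support of `x` plus possibly
  -- the apex, which is a clique of `R'`; this gives the homotopy from the retraction to the
  -- identity.
  have hsup : ∀ x ∈ cliqueSpace R', ∀ k l, (pushOff E a x k ≠ 0 ∨ x k ≠ 0) →
      (pushOff E a x l ≠ 0 ∨ x l ≠ 0) → R' k l := by
    intro x hx
    rcases hcases x hx with h | ⟨u, v, huv, hu, hv, huq⟩
    · rw [pushOff_eq_self hx.1.1 h]
      intro k l hk hl
      exact hx.2 k l (or_self_iff.mp hk) (or_self_iff.mp hl)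
    · have hval := pushOff_eq_of_unique (a := a) hx.1.1 huv huq
      have hsupp : ∀ k, (pushOff E a x k ≠ 0 ∨ x k ≠ 0) → k = a u v ∨ x k ≠ 0 := by
        intro k hk
        by_cases hka : k = a u v
        · exact Or.inl hka
        right
        intro hk0
        have hku : k ≠ u := fun h => hu (h ▸ hk0)
        have hkv : k ≠ v := fun h => hv (h ▸ hk0)
        rcases hk with hk | hk
        · rw [hval] at hk
          simp [hku, hkv, hka, hk0] at hk
        · exact hk hk0
      have hstar : ∀ k, x k ≠ 0 → R (a u v) k := by
        intro k hk
        by_cases hku : k = u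
        · exact hku ▸ (happ u v huv).2.1
        by_cases hkv : k = v
        · exact hkv ▸ (happ u v huv).2.2
        exact hcone u v k huv (hx.2 _ _ hu hk) (hx.2 _ _ hv hk) hku hkv
      intro k l hk hl
      rcases hsupp k hk with hka | hk' <;> rcases hsupp l hl with hla | hl'
      · rw [hka, hla]; exact hle _ _ (happ u v huv).1
      · rw [hka]; exact hle _ _ (hstar l hl')
      · rw [hla]; exact hle _ _ (hsymm _ _ (hstar k hk'))
      · exact hx.2 k l hk' hl'
  have hself : ∀ x ∈ cliqueSpace R, pushOff E a x = x := fun x hx =>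
    pushOff_eq_self hx.1.1 fun u v huv => by
      by_contra! h
      exact hER u v huv (hx.2 u v h.1 h.2)
  let inc : C(cliqueSpace R, cliqueSpace R') :=
    ⟨fun x => ⟨x.1, x.2.1, fun u v hu hv => hle u v (x.2.2 u v hu hv)⟩,
      Continuous.subtype_mk continuous_subtype_val _⟩
  let ret : C(cliqueSpace R', cliqueSpace R) :=
    ⟨fun x => ⟨pushOff E a x.1, hmem x.1 x.2⟩,
      Continuous.subtype_mk ((continuous_pushOff E a).comp continuous_subtype_val) _⟩
  refine ⟨⟨inc, ret, ?_, ?_⟩⟩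
  · have : ret.comp inc = ContinuousMap.id _ := by
      ext x : 1
      exact Subtype.ext (hself x.1 x.2)
    rw [this]
  · exact homotopic_of_support _ _ fun x u v hu hv => hsup x.1 x.2 u v hu hv

end Exchange

/-! ### Suspension as a join with two points. -/

section Suspension

variable {V : Type*}

/-- The relation on `V ⊕ Bool` whose clique complex is the join of that of `R` with two points. -/
def suspensionRelation (R : V → V → Prop) : V ⊕ Bool → V ⊕ Bool → Prop
  | Sum.inl u, Sum.inl v => R u v
  | Sum.inr a, Sum.inr b => a = b
  | _, _ => True

theorem suspensionRelation_symm {R : V → V → Prop} (hR : ∀ u v, R u v → R v u) (u v : V ⊕ Bool)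
    (h : suspensionRelation R u v) : suspensionRelation R v u := by
  rcases u with u | a <;> rcases v with v | b <;> simp only [suspensionRelation] at h ⊢
  · exact hR _ _ h
  · exact h.symm

variable [Fintype V]

/-- Closedness in the standard simplex gives compactness, so that a continuous bijection from the
suspension is a homeomorphism. -/
theorem isClosed_cliqueSpace (R : V → V → Prop) : IsClosed (cliqueSpace R) := by
  have h : cliqueSpace R = stdSimplex ℝ V ∩ ⋂ (u) (v) (_ : ¬ R u v), {x | x u * x v = 0} := by
    ext x
    simp only [cliqueSpace, Set.mem_inter_iff, Set.mem_iInter, Set.mem_ofPred_eq, mul_eq_zero]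
    refine and_congr_right fun _ => forall₂_congr fun u v => ?_
    tauto
  rw [h]
  refine (isClosed_stdSimplex ℝ V).inter (isClosed_iInter fun u => isClosed_iInter fun v =>
    isClosed_iInter fun _ => isClosed_eq ?_ continuous_const)
  exact (continuous_apply u).mul (continuous_apply v)

instance compactSpace_cliqueSpace (R : V → V → Prop) : CompactSpace (cliqueSpace R) :=
  isCompact_iff_compactSpace.mp
    ((isCompact_stdSimplex (𝕜 := ℝ) (ι := V)).of_isClosed_subset (isClosed_cliqueSpace R) fun _ h => h.1)

instance Suspension.instCompactSpace (X : Type*) [TopologicalSpace X] [CompactSpace X] :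
    CompactSpace (Suspension X) :=
  inferInstanceAs (CompactSpace (Quot (SuspensionRel X)))

/-- The weights of the point of the suspension at height `t` over the point `x`. -/
def suspensionWeights (x : V → ℝ) (t : ℝ) : V ⊕ Bool → ℝ
  | Sum.inl v => min (2 * t) (2 - 2 * t) * x v
  | Sum.inr false => max 0 (1 - 2 * t)
  | Sum.inr true => max 0 (2 * t - 1)

theorem suspensionWeights_mem {R : V → V → Prop} {x : V → ℝ} (hx : x ∈ cliqueSpace R) {t : ℝ}
    (h0 : 0 ≤ t) (h1 : t ≤ 1) :
    suspensionWeights x t ∈ cliqueSpace (suspensionRelation R) := by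
  refine ⟨⟨?_, ?_⟩, ?_⟩
  · rintro (v | _ | _)
    · exact mul_nonneg (le_min (by linarith) (by linarith)) (hx.1.1 v)
    · exact le_max_left _ _
    · exact le_max_left _ _
  · simp only [Fintype.sum_sum_type, suspensionWeights, ← Finset.mul_sum, hx.1.2, Fintype.sum_bool]
    rcases le_total t (1 / 2) with h | h
    · rw [min_eq_left (by linarith), max_eq_left (by linarith), max_eq_right (by linarith)]
      ring
    · rw [min_eq_right (by linarith), max_eq_right (by linarith), max_eq_left (by linarith)]
      ring
  · rintro (u | _ | _) (v | _ | _) hu hv <;> simp only [suspensionRelation]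
    · exact hx.2 u v (right_ne_zero_of_mul hu) (right_ne_zero_of_mul hv)
    all_goals
      simp only [suspensionWeights] at hu hv
      rcases le_total t (1 / 2) with h | h
      · first
        | exact absurd (max_eq_left (by linarith)) hu
        | exact absurd (max_eq_left (by linarith)) hv
      · first
        | exact absurd (max_eq_left (by linarith)) hu
        | exact absurd (max_eq_left (by linarith)) hv

theorem single_pole_mem [DecidableEq V] (R : V → V → Prop) (b : Bool) :
    (Pi.single (Sum.inr b) 1 : V ⊕ Bool → ℝ) ∈ cliqueSpace (suspensionRelation R) := by
  refine ⟨single_mem_stdSimplex ℝ _, fun u v hu hv => ?_⟩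
  have hu' : u = Sum.inr b := by_contra fun h => hu (Pi.single_eq_of_ne h _)
  have hv' : v = Sum.inr b := by_contra fun h => hv (Pi.single_eq_of_ne h _)
  subst hu' hv'
  rfl

open Classical in
/-- The comparison map from the suspension of a clique space. -/
noncomputable def suspensionMap (R : V → V → Prop) :
    Suspension (cliqueSpace R) → cliqueSpace (suspensionRelation R) :=
  Quot.lift
    (Sum.elim (fun p => ⟨suspensionWeights p.1.1 p.2, suspensionWeights_mem p.1.2 p.2.2.1 p.2.2.2⟩)
      fun b => ⟨Pi.single (Sum.inr b) 1, single_pole_mem R b⟩)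
    (by
      rintro _ _ (x | x) <;> refine Subtype.ext (funext ?_) <;> rintro (v | _ | _) <;>
        (simp [suspensionWeights]; try norm_num))

theorem continuous_suspensionMap (R : V → V → Prop) : Continuous (suspensionMap R) := by
  refine continuous_quot_lift _ (Continuous.sumElim ?_ continuous_of_discreteTopology)
  refine Continuous.subtype_mk (continuous_pi ?_) _
  have ht : Continuous fun p : cliqueSpace R × I => (p.2 : ℝ) :=
    continuous_subtype_val.comp continuous_snd
  rintro (v | _ | _) <;> simp only [suspensionWeights]
  · have hx : Continuous fun p : cliqueSpace R × I => p.1.1 v :=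
      (continuous_apply v).comp (continuous_subtype_val.comp continuous_fst)
    fun_prop
  · fun_prop
  · fun_prop

theorem suspension_cases {X : Type*} (z : Suspension X) :
    (∃ b, z = Quot.mk _ (Sum.inr b)) ∨
      ∃ (x : X) (t : I), (0 : ℝ) < t ∧ (t : ℝ) < 1 ∧ z = Quot.mk _ (Sum.inl (x, t)) := by
  obtain ⟨⟨x, t⟩ | b⟩ := z
  · rcases eq_or_ne t 0 with rfl | h0
    · exact Or.inl ⟨false, Quot.sound (.bottom x)⟩
    rcases eq_or_ne t 1 with rfl | h1
    · exact Or.inl ⟨true, Quot.sound (.top x)⟩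
    · exact Or.inr ⟨x, t, unitInterval.pos_iff_ne_zero.mpr h0, unitInterval.lt_one_iff_ne_one.mpr h1, rfl⟩
  · exact Or.inl ⟨b, rfl⟩

theorem suspensionWeights_pole_ne {R : V → V → Prop} (x : cliqueSpace R) {t : ℝ} (h0 : 0 < t)
    (h1 : t < 1) [DecidableEq (V ⊕ Bool)] (b : Bool) :
    suspensionWeights x.1 t (Sum.inr b) ≠ (Pi.single (Sum.inr b) 1 : V ⊕ Bool → ℝ) (Sum.inr b) := by
  rw [Pi.single_eq_same]
  cases b
  · exact (max_lt one_pos (by linarith)).ne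
  · exact (max_lt one_pos (by linarith)).ne

theorem bijective_suspensionMap (R : V → V → Prop) : Function.Bijective (suspensionMap R) := by
  classical
  constructor
  · intro z z' h
    have hval : ∀ k, (suspensionMap R z).1 k = (suspensionMap R z').1 k := fun k => by rw [h]
    rcases suspension_cases z with ⟨b, rfl⟩ | ⟨x, t, h0, h1, rfl⟩ <;>
      rcases suspension_cases z' with ⟨b', rfl⟩ | ⟨x', t', h0', h1', rfl⟩
    · have hb := hval (Sum.inr b)
      simp only [suspensionMap, Sum.elim_inr, Pi.single_apply, if_true, Sum.inr.injEq] at hb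
      by_cases hbb : b = b'
      · rw [hbb]
      · simp [hbb] at hb
    · exact absurd (hval (Sum.inr b)).symm (suspensionWeights_pole_ne x' h0' h1' b)
    · exact absurd (hval (Sum.inr b')) (suspensionWeights_pole_ne x h0 h1 b')
    · have hf : max 0 (1 - 2 * (t : ℝ)) = max 0 (1 - 2 * (t' : ℝ)) := hval (Sum.inr false)
      have ht : max 0 (2 * (t : ℝ) - 1) = max 0 (2 * (t' : ℝ) - 1) := hval (Sum.inr true)
      have htt : (t : ℝ) = t' := by
        rcases le_total (t : ℝ) (1 / 2) with h2 | h2 <;>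
          rcases le_total (t' : ℝ) (1 / 2) with h2' | h2' <;>
          simp only [max_def] at hf ht <;> split_ifs at hf ht <;> linarith
      obtain rfl : t = t' := Subtype.ext htt
      have hxx : x = x' := by
        refine Subtype.ext (funext fun v => ?_)
        have hv : min (2 * (t : ℝ)) (2 - 2 * t) * x.1 v = min (2 * (t : ℝ)) (2 - 2 * t) * x'.1 v :=
          hval (Sum.inl v)
        exact mul_left_cancel₀ (lt_min (by linarith) (by linarith)).ne' hv
      rw [hxx]
  · rintro ⟨y, hy⟩
    have hsum := hy.1.2
    rw [Fintype.sum_sum_type, Fintype.sum_bool] at hsum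
    have hf := hy.1.1 (Sum.inr false)
    have ht := hy.1.1 (Sum.inr true)
    have hs : 0 ≤ ∑ v, y (Sum.inl v) := Finset.sum_nonneg fun v _ => hy.1.1 _
    have hft : y (Sum.inr false) = 0 ∨ y (Sum.inr true) = 0 := by
      by_contra! hc
      exact Bool.false_ne_true (hy.2 _ _ hc.1 hc.2)
    rcases hs.eq_or_lt with hs | hs
    · have hl : ∀ v, y (Sum.inl v) = 0 := fun v =>
        (Finset.sum_eq_zero_iff_of_nonneg fun v _ => hy.1.1 (Sum.inl v)).mp hs.symm v
          (Finset.mem_univ v)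
      rcases hft with h | h
      · refine ⟨Quot.mk _ (Sum.inr true), Subtype.ext (funext ?_)⟩
        rintro (v | _ | _) <;> simp [suspensionMap, hl, h]
        linarith
      · refine ⟨Quot.mk _ (Sum.inr false), Subtype.ext (funext ?_)⟩
        rintro (v | _ | _) <;> simp [suspensionMap, hl, h]
        linarith
    · set s := ∑ v, y (Sum.inl v) with hs_def
      have hx : (fun v => y (Sum.inl v) / s) ∈ cliqueSpace R := by
        refine ⟨⟨fun v => div_nonneg (hy.1.1 _) hs.le, ?_⟩, fun u v hu hv => ?_⟩
        · rw [← Finset.sum_div, ← hs_def, div_self hs.ne']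
        · exact hy.2 (Sum.inl u) (Sum.inl v) (fun h => hu (by simp [h])) fun h => hv (by simp [h])
      -- At most one pole carries weight, so the difference of the two pole weights determines the
      -- height: it equals `2t - 1`.
      have htI : (1 - y (Sum.inr false) + y (Sum.inr true)) / 2 ∈ I := by
        constructor <;> linarith
      refine ⟨Quot.mk _ (Sum.inl (⟨_, hx⟩, ⟨_, htI⟩)), Subtype.ext (funext ?_)⟩
      rintro (v | _ | _)
      · change min _ _ * (y (Sum.inl v) / s) = y (Sum.inl v)
        have hmin : min (2 * ((1 - y (Sum.inr false) + y (Sum.inr true)) / 2))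
            (2 - 2 * ((1 - y (Sum.inr false) + y (Sum.inr true)) / 2)) = s := by
          rcases hft with h | h
          · rw [min_eq_right (by linarith)]; linarith
          · rw [min_eq_left (by linarith)]; linarith
        rw [hmin, mul_div_cancel₀ _ hs.ne']
      · change max 0 (1 - 2 * ((1 - y (Sum.inr false) + y (Sum.inr true)) / 2)) = _
        rcases hft with h | h
        · rw [max_eq_left (by linarith)]; exact h.symm
        · rw [max_eq_right (by linarith)]; linarith
      · change max 0 (2 * ((1 - y (Sum.inr false) + y (Sum.inr true)) / 2) - 1) = _
        rcases hft with h | h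
        · rw [max_eq_right (by linarith)]; linarith
        · rw [max_eq_left (by linarith)]; exact h.symm

/-- The suspension of a clique space is the clique space of the join with two points. -/
noncomputable def suspensionHomeomorph (R : V → V → Prop) :
    Suspension (cliqueSpace R) ≃ₜ cliqueSpace (suspensionRelation R) :=
  (continuous_suspensionMap R).homeoOfEquivCompactToT2 (f := Equiv.ofBijective _ (bijective_suspensionMap R))

/-- The map of suspensions induced by a map of spaces. -/
def Suspension.map {X Y : Type*} (f : X → Y) : Suspension X → Suspension Y :=
  Quot.map (Sum.map (Prod.map f id) id) (by rintro _ _ (x | x) <;> constructor)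

theorem Suspension.continuous_map {X Y : Type*} [TopologicalSpace X] [TopologicalSpace Y] {f : X → Y}
    (hf : Continuous f) : Continuous (Suspension.map f) :=
  continuous_quot_lift _ (continuous_quot_mk.comp ((hf.prodMap continuous_id).sumMap continuous_id))

/-- Homeomorphic spaces have homeomorphic suspensions. -/
def Suspension.homeomorph {X Y : Type*} [TopologicalSpace X] [TopologicalSpace Y] (e : X ≃ₜ Y) :
    Suspension X ≃ₜ Suspension Y where
  toFun := Suspension.map e
  invFun := Suspension.map e.symm
  left_inv := by rintro ⟨⟨x, t⟩ | b⟩ <;> simp [Suspension.map, Quot.map] <;> rfl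
  right_inv := by rintro ⟨⟨x, t⟩ | b⟩ <;> simp [Suspension.map, Quot.map] <;> rfl
  continuous_toFun := Suspension.continuous_map e.continuous
  continuous_invFun := Suspension.continuous_map e.symm.continuous

end Suspension

/-! ### The strip model and its relations. -/

section StripModel

/-- The vertices of the model: three blocks of `r + 1` vertices and a cycle of `N` vertices. -/
inductive StripVertex (r N : ℕ)
  | left (a : Fin (r + 1))
  | middle (a : Fin (r + 1))
  | right (a : Fin (r + 1))
  | outer (j : Fin N)
  deriving Fintype

/-- Two vertices of the `N`-cycle are equal or at distance greater than `r`. -/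
def CycleFar (r N : ℕ) (i j : Fin N) : Prop :=
  i = j ∨ ((i : ℕ) + r < j ∧ (j : ℕ) + r < i + N) ∨ ((j : ℕ) + r < i ∧ (i : ℕ) + r < j + N)

/-- Which optional edges are present in a strip relation. -/
structure StripOptions where
  /-- Consecutive left vertices are related. -/
  leftLeft : Prop
  /-- Consecutive right vertices are related. -/
  rightRight : Prop
  /-- All left vertices are related to all outer vertices. -/
  leftOuter : Prop
  /-- All right vertices are related to all outer vertices. -/
  rightOuter : Prop
  /-- All middle vertices are related to all outer vertices. -/
  middleOuter : Prop

open StripVertex in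
/-- The non-adjacency relation of the extended cycle power, with some optional further edges. -/
def stripRelation (r N : ℕ) (o : StripOptions) : StripVertex r N → StripVertex r N → Prop
  | left a, left b => a = b ∨ (o.leftLeft ∧ ((b : ℕ) = a + 1 ∨ (a : ℕ) = b + 1))
  | left a, middle b | middle b, left a => (b : ℕ) = a ∨ (b : ℕ) = a + 1
  | left a, right c | right c, left a => (c : ℕ) = a ∨ (c : ℕ) = a + 1 ∨ ((a : ℕ) = r ∧ (c : ℕ) = 0)
  | middle a, middle b => a = b
  | middle b, right c | right c, middle b => (c : ℕ) = b ∨ (c : ℕ) = b + 1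
  | right a, right b => a = b ∨ (o.rightRight ∧ ((b : ℕ) = a + 1 ∨ (a : ℕ) = b + 1))
  | left a, outer j | outer j, left a => o.leftOuter ∨ r + j < N + a
  | right c, outer j | outer j, right c => o.rightOuter ∨ (c : ℕ) ≤ j
  | middle b, outer j | outer j, middle b =>
      o.middleOuter ∨ ¬ ((b : ℕ) = r ∧ (j : ℕ) + 1 = N) ∧ ¬ ((b : ℕ) = 0 ∧ (j : ℕ) = 0)
  | outer i, outer j => CycleFar r N i j

variable {r N : ℕ}

theorem CycleFar.symm {i j : Fin N} (h : CycleFar r N i j) : CycleFar r N j i := by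
  unfold CycleFar at *
  rcases h with rfl | h | h
  · exact Or.inl rfl
  · exact Or.inr (Or.inr h)
  · exact Or.inr (Or.inl h)

theorem stripRelation_symm {o : StripOptions} (u v : StripVertex r N)
    (h : stripRelation r N o u v) : stripRelation r N o v u := by
  rcases u with a | a | a | a <;> rcases v with b | b | b | b <;>
    simp only [stripRelation] at h ⊢ <;> first | exact h | exact h.symm | skip
  all_goals
    rcases h with h | ⟨h, h'⟩
    · exact Or.inl h.symm
    · exact Or.inr ⟨h, h'.symm⟩

open StripVertex

/-! ### Exchange moves on the strip. -/

/-- Making consecutive right vertices related does not change the homotopy type. -/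
theorem homotopyEquiv_rightRight (hr : 2 ≤ r) (P : Prop) :
    Nonempty (ContinuousMap.HomotopyEquiv
      (cliqueSpace (stripRelation r N ⟨False, False, P, False, True⟩))
      (cliqueSpace (stripRelation r N ⟨False, True, P, False, True⟩))) := by
  refine nonempty_homotopyEquiv_of_exchange
    (fun u v => ∃ a b : Fin (r + 1), (b : ℕ) = a + 1 ∧ u = right a ∧ v = right b)
    stripRelation_symm ?_ ?_ ?_ ?_ ?_ ?_
  · rintro (a | a | a | a) (b | b | b | b) h <;> simp [stripRelation, -Fin.val_eq_zero_iff] at h ⊢ <;>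
      tauto
  · rintro (a | a | a | a) (b | b | b | b) h <;> simp [stripRelation, -Fin.val_eq_zero_iff] at h ⊢ <;>
      tauto
  · rintro _ _ ⟨a, b, hab, rfl, rfl⟩
    simp [stripRelation, Fin.ext_iff, -Fin.val_eq_zero_iff]
    omega
  · rintro _ _ ⟨a, b, hab, rfl, rfl⟩
    simp [Fin.ext_iff, -Fin.val_eq_zero_iff]
    omega
  · rintro _ _ _ _ ⟨a, b, hab, rfl, rfl⟩ ⟨a', b', hab', rfl, rfl⟩
    simp [stripRelation, Fin.ext_iff, -Fin.val_eq_zero_iff]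
    omega
  · rintro _ _ ⟨a, b, hab, rfl, rfl⟩
    -- The common link consists of `left a`, `middle a` and outer vertices. For `r = 1` the
    -- exceptional pair `left r`, `right 0` would add `left 1` and destroy the cone; hence `2 ≤ r`.
    refine ⟨middle a, ?_, ?_, ?_, ?_⟩
    · simp [stripRelation, -Fin.val_eq_zero_iff]
    · simp [stripRelation, -Fin.val_eq_zero_iff]
    · simp [stripRelation, -Fin.val_eq_zero_iff]
      omega
    · rintro (c | c | c | c) <;> simp [stripRelation, Fin.ext_iff, -Fin.val_eq_zero_iff] <;> omega

/-- Relating all left vertices to all outer vertices does not change the homotopy type. -/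
theorem homotopyEquiv_leftOuter (hr : 1 ≤ r) (hN : 2 * r + 1 ≤ N) :
    Nonempty (ContinuousMap.HomotopyEquiv
      (cliqueSpace (stripRelation r N ⟨False, True, False, False, True⟩))
      (cliqueSpace (stripRelation r N ⟨False, True, True, False, True⟩))) := by
  refine nonempty_homotopyEquiv_of_exchange
    (fun u v => ∃ (j : Fin N) (a : Fin (r + 1)), N + (a : ℕ) ≤ r + j ∧ u = outer j ∧ v = left a)
    stripRelation_symm ?_ ?_ ?_ ?_ ?_ ?_
  · rintro (a | a | a | a) (b | b | b | b) h <;> simp [stripRelation, -Fin.val_eq_zero_iff] at h ⊢ <;>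
      tauto
  · rintro (a | a | a | a) (b | b | b | b) h <;> simp [stripRelation, -Fin.val_eq_zero_iff] at h ⊢ <;>
      first | tauto | omega
  · rintro _ _ ⟨j, a, hj, rfl, rfl⟩
    simp [stripRelation, -Fin.val_eq_zero_iff]
    omega
  · rintro _ _ ⟨j, a, hj, rfl, rfl⟩
    simp [-Fin.val_eq_zero_iff]
  -- Distinct left vertices are unrelated here, and two outer vertices among the last `r` are too
  -- close to be related.
  · rintro _ _ _ _ ⟨j, a, hj, rfl, rfl⟩ ⟨j', a', hj', rfl, rfl⟩
    simp [stripRelation, CycleFar, Fin.ext_iff, -Fin.val_eq_zero_iff]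
    omega
  · rintro _ _ ⟨j, a, hj, rfl, rfl⟩
    -- Since `j < N`, the inserted pair has `a < r`, so this vertex exists. It is related to `right
    -- a`, also in the link, only through the right-right option; outer vertices far from `j` have
    -- index at least `a + 1`.
    refine ⟨right ⟨a + 1, by omega⟩, ?_, ?_, ?_, ?_⟩
    · simp [stripRelation, -Fin.val_eq_zero_iff]
    · simp [stripRelation, -Fin.val_eq_zero_iff]
      omega
    · simp [stripRelation, -Fin.val_eq_zero_iff]
    · rintro (c | c | c | c) <;> simp [stripRelation, CycleFar, Fin.ext_iff, -Fin.val_eq_zero_iff] <;> omega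

/-- Making consecutive left vertices related does not change the homotopy type. -/
theorem homotopyEquiv_leftLeft (hr : 2 ≤ r) :
    Nonempty (ContinuousMap.HomotopyEquiv
      (cliqueSpace (stripRelation r N ⟨False, False, True, False, True⟩))
      (cliqueSpace (stripRelation r N ⟨True, False, True, False, True⟩))) := by
  refine nonempty_homotopyEquiv_of_exchange
    (fun u v => ∃ a b : Fin (r + 1), (b : ℕ) = a + 1 ∧ u = left a ∧ v = left b)
    stripRelation_symm ?_ ?_ ?_ ?_ ?_ ?_
  · rintro (a | a | a | a) (b | b | b | b) h <;> simp [stripRelation, -Fin.val_eq_zero_iff] at h ⊢ <;>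
      tauto
  · rintro (a | a | a | a) (b | b | b | b) h <;> simp [stripRelation, -Fin.val_eq_zero_iff] at h ⊢ <;>
      tauto
  · rintro _ _ ⟨a, b, hab, rfl, rfl⟩
    simp [stripRelation, Fin.ext_iff, -Fin.val_eq_zero_iff]
    omega
  · rintro _ _ ⟨a, b, hab, rfl, rfl⟩
    simp [Fin.ext_iff, -Fin.val_eq_zero_iff]
    omega
  · rintro _ _ _ _ ⟨a, b, hab, rfl, rfl⟩ ⟨a', b', hab', rfl, rfl⟩
    simp [stripRelation, Fin.ext_iff, -Fin.val_eq_zero_iff]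
    omega
  · rintro _ _ ⟨a, b, hab, rfl, rfl⟩
    -- The link contains only `middle b`, `right b` and outer vertices; `2 ≤ r` again excludes the
    -- exceptional pair.
    refine ⟨middle b, ?_, ?_, ?_, ?_⟩
    · simp [stripRelation, -Fin.val_eq_zero_iff]
    · simp [stripRelation, -Fin.val_eq_zero_iff]
      omega
    · simp [stripRelation, -Fin.val_eq_zero_iff]
    · rintro (c | c | c | c) <;> simp [stripRelation, Fin.ext_iff, -Fin.val_eq_zero_iff] <;> omega

/-- Relating all right vertices to all outer vertices does not change the homotopy type. -/
theorem homotopyEquiv_rightOuter (hr : 1 ≤ r) :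
    Nonempty (ContinuousMap.HomotopyEquiv
      (cliqueSpace (stripRelation r N ⟨True, False, True, False, True⟩))
      (cliqueSpace (stripRelation r N ⟨True, False, True, True, True⟩))) := by
  refine nonempty_homotopyEquiv_of_exchange
    (fun u v => ∃ (j : Fin N) (a : Fin (r + 1)), (j : ℕ) < a ∧ u = outer j ∧ v = right a)
    stripRelation_symm ?_ ?_ ?_ ?_ ?_ ?_
  · rintro (a | a | a | a) (b | b | b | b) h <;> simp [stripRelation, -Fin.val_eq_zero_iff] at h ⊢ <;>
      tauto
  · rintro (a | a | a | a) (b | b | b | b) h <;> simp [stripRelation, -Fin.val_eq_zero_iff] at h ⊢ <;>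
      first | tauto | omega
  · rintro _ _ ⟨j, a, hj, rfl, rfl⟩
    simp [stripRelation, -Fin.val_eq_zero_iff]
    omega
  · rintro _ _ ⟨j, a, hj, rfl, rfl⟩
    simp [-Fin.val_eq_zero_iff]
  -- This is where the right-right option must be off: otherwise a clique could contain two
  -- consecutive right vertices and an outer vertex missing from both.
  · rintro _ _ _ _ ⟨j, a, hj, rfl, rfl⟩ ⟨j', a', hj', rfl, rfl⟩
    simp [stripRelation, CycleFar, Fin.ext_iff, -Fin.val_eq_zero_iff]
    omega
  · rintro _ _ ⟨j, a, hj, rfl, rfl⟩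
    -- Here `j < a` forces `a ≥ 1`. The link also contains `left a`, which the left-left option
    -- relates to the apex; the outer part is covered by the left-outer option.
    refine ⟨left ⟨a - 1, by omega⟩, ?_, ?_, ?_, ?_⟩
    · simp [stripRelation, -Fin.val_eq_zero_iff]
    · simp [stripRelation, -Fin.val_eq_zero_iff]
    · simp [stripRelation, -Fin.val_eq_zero_iff]
      omega
    · rintro (c | c | c | c) <;> simp [stripRelation, CycleFar, Fin.ext_iff, -Fin.val_eq_zero_iff] <;> omega

/-- For `r = 1`, two pairs of middle and outer vertices can be made unrelated. -/
theorem homotopyEquiv_middleOuter_one :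
    Nonempty (ContinuousMap.HomotopyEquiv
      (cliqueSpace (stripRelation 1 N ⟨False, False, False, False, False⟩))
      (cliqueSpace (stripRelation 1 N ⟨False, False, False, False, True⟩))) := by
  refine nonempty_homotopyEquiv_of_exchange
    (fun u v => ∃ (j : Fin N) (b : Fin 2), ((b : ℕ) = 1 ∧ (j : ℕ) + 1 = N ∨ (b : ℕ) = 0 ∧ (j : ℕ) = 0) ∧
      u = outer j ∧ v = middle b)
    stripRelation_symm ?_ ?_ ?_ ?_ ?_ ?_
  · rintro (a | a | a | a) (b | b | b | b) h <;> simp [stripRelation, -Fin.val_eq_zero_iff] at h ⊢ <;>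
      tauto
  · rintro (a | a | a | a) (b | b | b | b) h <;> simp [stripRelation, -Fin.val_eq_zero_iff] at h ⊢ <;>
      tauto
  · rintro _ _ ⟨j, b, hj, rfl, rfl⟩
    simp [stripRelation, -Fin.val_eq_zero_iff]
    omega
  · rintro _ _ ⟨j, b, hj, rfl, rfl⟩
    simp [-Fin.val_eq_zero_iff]
  · rintro _ _ _ _ ⟨j, b, hj, rfl, rfl⟩ ⟨j', b', hj', rfl, rfl⟩
    simp [stripRelation, CycleFar, Fin.ext_iff, -Fin.val_eq_zero_iff]
    omega
  -- In the strip, `middle 1` and the last outer vertex have common neighbours `left 1`, `right 1`,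
  -- while `middle 0` and the first have `left 0`, `right 0`.
  · rintro _ _ ⟨j, b, hj | hj, rfl, rfl⟩
    · refine ⟨left b, ?_, ?_, ?_, ?_⟩
      · simp [stripRelation, -Fin.val_eq_zero_iff]
      · simp [stripRelation, -Fin.val_eq_zero_iff]
        omega
      · simp [stripRelation, -Fin.val_eq_zero_iff]
      · rintro (c | c | c | c) <;> simp [stripRelation, CycleFar, Fin.ext_iff, -Fin.val_eq_zero_iff] <;> omega
    · refine ⟨right b, ?_, ?_, ?_, ?_⟩
      · simp [stripRelation, -Fin.val_eq_zero_iff]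
      · simp [stripRelation, -Fin.val_eq_zero_iff]
        omega
      · simp [stripRelation, -Fin.val_eq_zero_iff]
      · rintro (c | c | c | c) <;> simp [stripRelation, CycleFar, Fin.ext_iff, -Fin.val_eq_zero_iff] <;> omega

/-- For `r = 1`, all left and right vertices can be related to all outer vertices. -/
theorem homotopyEquiv_leftRightOuter_one (hN : 3 ≤ N) :
    Nonempty (ContinuousMap.HomotopyEquiv
      (cliqueSpace (stripRelation 1 N ⟨False, False, False, False, False⟩))
      (cliqueSpace (stripRelation 1 N ⟨False, False, True, True, False⟩))) := by
  refine nonempty_homotopyEquiv_of_exchange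
    (fun u v => ∃ (j : Fin N) (a : Fin 2), u = outer j ∧
      (N + (a : ℕ) ≤ 1 + j ∧ v = left a ∨ (j : ℕ) < a ∧ v = right a))
    stripRelation_symm ?_ ?_ ?_ ?_ ?_ ?_
  · rintro (a | a | a | a) (b | b | b | b) h <;> simp [stripRelation, -Fin.val_eq_zero_iff] at h ⊢ <;>
      tauto
  · rintro (a | a | a | a) (b | b | b | b) h <;> simp [stripRelation, -Fin.val_eq_zero_iff] at h ⊢ <;>
      first | tauto | omega
  · rintro _ _ ⟨j, a, rfl, ⟨hj, rfl⟩ | ⟨hj, rfl⟩⟩ <;>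
      simp [stripRelation, -Fin.val_eq_zero_iff] <;> omega
  · rintro _ _ ⟨j, a, rfl, ⟨hj, rfl⟩ | ⟨hj, rfl⟩⟩ <;> simp
  · rintro _ _ _ _ ⟨j, a, rfl, ⟨hj, rfl⟩ | ⟨hj, rfl⟩⟩ ⟨j', a', rfl, ⟨hj', rfl⟩ | ⟨hj', rfl⟩⟩ <;>
      simp [stripRelation, CycleFar, Fin.ext_iff, -Fin.val_eq_zero_iff] <;> omega
  · rintro _ _ ⟨j, a, rfl, ⟨hj, rfl⟩ | ⟨hj, rfl⟩⟩
    all_goals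
      -- In the strip, the link of `left 0` is the path `middle 1`, `right 1`, `middle 0`, `right
      -- 0`. Without the pair of `middle 1` and the last outer vertex, only a path with centre
      -- `middle 0` remains. The case of `right 1` is the mirror image.
      refine ⟨middle a, ?_, ?_, ?_, ?_⟩
      · simp [stripRelation, -Fin.val_eq_zero_iff]
      · simp [stripRelation, -Fin.val_eq_zero_iff]
        omega
      · simp [stripRelation, -Fin.val_eq_zero_iff]
      · rintro (c | c | c | c) <;> simp [stripRelation, CycleFar, Fin.ext_iff, -Fin.val_eq_zero_iff] <;> omega

/-! ### Joins with cycles, and folding the strip. -/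

/-- The relation of the join of a cycle of length `k` with the relation `S`. -/
def cycleJoinRelation {β : Type*} (k : ℕ) (S : β → β → Prop) : Fin k ⊕ β → Fin k ⊕ β → Prop
  | Sum.inl i, Sum.inl j => i = j ∨ (i : ℕ) + 1 = j ∨ (j : ℕ) + 1 = i ∨
      ((i : ℕ) = 0 ∧ (j : ℕ) + 1 = k) ∨ ((j : ℕ) = 0 ∧ (i : ℕ) + 1 = k)
  | Sum.inr a, Sum.inr b => S a b
  | _, _ => True

theorem cycleJoinRelation_symm {β : Type*} {k : ℕ} {S : β → β → Prop} (hS : ∀ a b, S a b → S b a)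
    (u v : Fin k ⊕ β) (h : cycleJoinRelation k S u v) : cycleJoinRelation k S v u := by
  rcases u with i | a <;> rcases v with j | b <;> simp only [cycleJoinRelation] at h ⊢
  · rw [eq_comm]
    tauto
  · exact hS _ _ h

/-- A cycle of length at least four in a join can be shortened to length four. -/
theorem homotopyEquiv_cycleJoin {β : Type*} [Fintype β] {S : β → β → Prop}
    (hS : ∀ a b, S a b → S b a) {k : ℕ} (hk : 4 ≤ k) :
    Nonempty (ContinuousMap.HomotopyEquiv
      (cliqueSpace (cycleJoinRelation k S)) (cliqueSpace (cycleJoinRelation 4 S))) := by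
  induction k, hk using Nat.le_induction with
  | base => exact ⟨.refl _⟩
  | succ k hk ih =>
    -- The chord joins the two neighbours of the last vertex `k`. In a cycle of length at least
    -- five, `k` is their only common neighbour on the cycle, so it is a cone apex; after insertion,
    -- `k` is dominated by `k - 1` and folds onto it.
    let E : Fin (k + 1) ⊕ β → Fin (k + 1) ⊕ β → Prop := fun u v =>
      ∃ i j : Fin (k + 1), ((i : ℕ) = 0 ∧ (j : ℕ) + 1 = k) ∧ u = Sum.inl i ∧ v = Sum.inl j
    let R' : Fin (k + 1) ⊕ β → Fin (k + 1) ⊕ β → Prop := fun u v =>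
      cycleJoinRelation (k + 1) S u v ∨ E u v ∨ E v u
    have hadd : Nonempty (ContinuousMap.HomotopyEquiv
        (cliqueSpace (cycleJoinRelation (k + 1) S)) (cliqueSpace R')) := by
      refine nonempty_homotopyEquiv_of_exchange E (cycleJoinRelation_symm hS)
        (fun u v h => Or.inl h) (fun u v h => h) ?_ ?_ ?_ ?_
      · rintro _ _ ⟨i, j, hij, rfl, rfl⟩
        simp [cycleJoinRelation, Fin.ext_iff, -Fin.val_eq_zero_iff]
        omega
      · rintro _ _ ⟨i, j, hij, rfl, rfl⟩
        simp [Fin.ext_iff]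
        omega
      · rintro _ _ _ _ ⟨i, j, hij, rfl, rfl⟩ ⟨i', j', hij', rfl, rfl⟩ - - - -
        simp [Fin.ext_iff]
        omega
      · rintro _ _ ⟨i, j, hij, rfl, rfl⟩
        refine ⟨Sum.inl (Fin.last k), ?_, ?_, ?_, ?_⟩
        · simp [cycleJoinRelation]
        · simp [cycleJoinRelation, Fin.ext_iff, -Fin.val_eq_zero_iff]
          omega
        · simp [cycleJoinRelation, Fin.ext_iff, -Fin.val_eq_zero_iff]
          omega
        · rintro (c | c)
          · simp [R', E, cycleJoinRelation, -Fin.val_eq_zero_iff]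
            simp only [Fin.ext_iff, Fin.val_last]
            omega
          · simp [cycleJoinRelation]
    have hfold : Nonempty (ContinuousMap.HomotopyEquiv
        (cliqueSpace R') (cliqueSpace (cycleJoinRelation k S))) := by
      have hR' : ∀ u v, R' u v → R' v u := fun u v h =>
        h.imp (cycleJoinRelation_symm hS u v) Or.symm
      refine nonempty_homotopyEquiv_of_contiguous hR' (cycleJoinRelation_symm hS)
        (Sum.map (fun i => ⟨min i (k - 1), by omega⟩) id) (Sum.map Fin.castSucc id) ?_ ?_ ?_ ?_
      · rintro (i | a) (j | b) <;>
          simp [R', E, cycleJoinRelation, -Fin.val_eq_zero_iff]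
        simp only [Fin.ext_iff]
        omega
      · rintro (i | a) (j | b) <;>
          simp [R', E, cycleJoinRelation, -Fin.val_eq_zero_iff]
        simp only [Fin.ext_iff]
        omega
      · rintro (i | a) (j | b) <;>
          simp [R', E, cycleJoinRelation, -Fin.val_eq_zero_iff]
        simp only [Fin.ext_iff]
        omega
      · rintro (i | a) (j | b) <;>
          simp [cycleJoinRelation, Fin.ext_iff, -Fin.val_eq_zero_iff]
        omega
    obtain ⟨e⟩ := hadd
    obtain ⟨e'⟩ := hfold
    obtain ⟨e''⟩ := ih
    exact ⟨(e.trans e').trans e''⟩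

/-- The join with a cycle of length four is the double suspension. -/
theorem homotopyEquiv_cycleJoin_four {β : Type*} [Fintype β] {S : β → β → Prop}
    (hS : ∀ a b, S a b → S b a) :
    Nonempty (ContinuousMap.HomotopyEquiv (cliqueSpace (cycleJoinRelation 4 S))
      (cliqueSpace (suspensionRelation (suspensionRelation S)))) := by
  refine nonempty_homotopyEquiv_of_contiguous (cycleJoinRelation_symm hS)
    (suspensionRelation_symm (suspensionRelation_symm hS))
    -- Opposite vertices of the 4-cycle are the unrelated pairs, so `0, 2` become the outer poles
    -- and `1, 3` the inner ones.
    (Sum.elim ![Sum.inr false, Sum.inl (Sum.inr false), Sum.inr true, Sum.inl (Sum.inr true)]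
      (Sum.inl ∘ Sum.inl))
    (Sum.elim (Sum.elim Sum.inr fun b => Sum.inl (bif b then 3 else 1))
      fun b => Sum.inl (bif b then 2 else 0)) ?_ ?_ ?_ ?_
  · rintro (i | a) (j | b) <;> [skip; skip; skip; exact id]
    · fin_cases i <;> fin_cases j <;> simp [cycleJoinRelation, suspensionRelation]
    · fin_cases i <;> simp [cycleJoinRelation, suspensionRelation]
    · fin_cases j <;> simp [cycleJoinRelation, suspensionRelation]
  · rintro ((a | _ | _) | _ | _) ((b | _ | _) | _ | _) <;>
      simp [cycleJoinRelation, suspensionRelation]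
  · rintro (i | a) (j | b) h <;> [skip; skip; skip; exact h]
    · fin_cases i <;> fin_cases j <;> simp [cycleJoinRelation] at h ⊢
    · simp [cycleJoinRelation]
    · fin_cases j <;> simp [cycleJoinRelation]
  · rintro ((a | _ | _) | _ | _) ((b | _ | _) | _ | _) h <;>
      simp [suspensionRelation] at h ⊢
    exact h

/-- The strip, joined with all outer vertices, folds onto a cycle of length `r + 2`. -/
theorem homotopyEquiv_fold :
    Nonempty (ContinuousMap.HomotopyEquiv
      (cliqueSpace (stripRelation r N ⟨True, False, True, True, True⟩))
      (cliqueSpace (cycleJoinRelation (r + 2) (CycleFar r N)))) := by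
  refine nonempty_homotopyEquiv_of_contiguous stripRelation_symm
    (cycleJoinRelation_symm fun _ _ => CycleFar.symm)
    -- The target cycle is `right 0, left 0, …, left r`, closed by the exceptional pair `left r`,
    -- `right 0`. Each `middle b` is dominated by `left b`, and each `right c` with `c ≥ 1` by `left
    -- (c - 1)`.
    (fun u => match u with
      | left a => Sum.inl a.succ
      | middle b => Sum.inl b.succ
      | right c => Sum.inl c.castSucc
      | outer j => Sum.inr j)
    (Sum.elim (Fin.cases (right 0) left) outer) ?_ ?_ ?_ ?_
  · rintro (a | a | a | a) (b | b | b | b) <;>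
      simp [stripRelation, cycleJoinRelation, Fin.ext_iff, -Fin.val_eq_zero_iff] <;> omega
  · rintro (i | a) (j | b)
    · cases i using Fin.cases <;> cases j using Fin.cases <;>
        simp [stripRelation, cycleJoinRelation, Fin.ext_iff, -Fin.val_eq_zero_iff] <;> omega
    · cases i using Fin.cases <;> simp [stripRelation]
    · cases j using Fin.cases <;> simp [stripRelation]
    · exact id
  · rintro (a | a | a | a) (b | b | c | b)
    all_goals try (cases c using Fin.cases)
    all_goals
      simp [stripRelation, Fin.ext_iff, -Fin.val_eq_zero_iff]
    all_goals try omega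
  · rintro (i | a) (j | b)
    · cases j using Fin.cases <;>
        simp [cycleJoinRelation, Fin.ext_iff, -Fin.val_eq_zero_iff]
    · simp [cycleJoinRelation]
    · cases j using Fin.cases <;> simp [cycleJoinRelation]
    · exact id

/-- For `r = 1`, the strip folds onto a cycle of length four. -/
theorem homotopyEquiv_fold_one :
    Nonempty (ContinuousMap.HomotopyEquiv
      (cliqueSpace (stripRelation 1 N ⟨False, False, True, True, False⟩))
      (cliqueSpace (cycleJoinRelation 4 (CycleFar 1 N)))) := by
  refine nonempty_homotopyEquiv_of_contiguous stripRelation_symm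
    (cycleJoinRelation_symm fun _ _ => CycleFar.symm)
    -- The target cycle is `right 0, left 0, right 1, left 1`; `middle 0` is dominated by `left 0`
    -- and `middle 1` by `right 1`.
    (fun u => match u with
      | left a => Sum.inl (![1, 3] a)
      | middle b => Sum.inl (![1, 2] b)
      | right c => Sum.inl (![0, 2] c)
      | outer j => Sum.inr j)
    (Sum.elim ![right 0, left 0, right 1, left 1] outer) ?_ ?_ ?_ ?_
  · rintro (a | a | a | a) (b | b | b | b)
    all_goals try fin_cases a
    all_goals try fin_cases b
    all_goals simp [stripRelation, cycleJoinRelation]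
  · rintro (i | a) (j | b)
    · fin_cases i <;> fin_cases j <;> simp [stripRelation, cycleJoinRelation]
    · fin_cases i <;> simp [stripRelation]
    · fin_cases j <;> simp [stripRelation]
    · exact id
  · rintro (a | a | a | a) (b | b | b | b)
    all_goals try fin_cases a
    all_goals try fin_cases b
    all_goals simp [stripRelation]
  · rintro (i | a) (j | b)
    · fin_cases i <;> fin_cases j <;> simp [cycleJoinRelation]
    · simp [cycleJoinRelation]
    · fin_cases j <;> simp [cycleJoinRelation]
    · exact id

end StripModel

/-! ### Distance in the cycle graph. -/

section CycleDistance

theorem cycleGraph_adj_iff {n : ℕ} (hn : 2 ≤ n) (u v : Fin n) :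
    (SimpleGraph.cycleGraph n).Adj u v ↔ (u : ℕ) + 1 = v ∨ (v : ℕ) + 1 = u ∨
      ((u : ℕ) = 0 ∧ (v : ℕ) + 1 = n) ∨ ((v : ℕ) = 0 ∧ (u : ℕ) + 1 = n) := by
  rw [SimpleGraph.cycleGraph_adj', Fin.val_sub, Fin.val_sub]
  have h : ∀ a b : Fin n, (n - (b : ℕ) + a) % n = if (b : ℕ) ≤ a then (a : ℕ) - b else n - b + a := by
    intro a b
    split_ifs with hab
    · rw [show n - (b : ℕ) + a = (a - b) + n by omega, Nat.add_mod_right, Nat.mod_eq_of_lt (by omega)]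
    · exact Nat.mod_eq_of_lt (by omega)
  rw [h, h]
  split_ifs <;> omega

/-- The vertices `u` and `v` of the `n`-cycle are at distance at most `k`. -/
def CycleNear (k : ℕ) {n : ℕ} (u v : Fin n) : Prop :=
  ((u : ℕ) ≤ v + k ∧ (v : ℕ) ≤ u + k) ∨ (u : ℕ) + n ≤ v + k ∨ (v : ℕ) + n ≤ u + k

theorem cycleNear_length {n : ℕ} (hn : 2 ≤ n) {u v : Fin n}
    (p : (SimpleGraph.cycleGraph n).Walk u v) : CycleNear p.length u v := by
  induction p with
  | nil => exact Or.inl ⟨le_rfl, le_rfl⟩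
  | cons h p ih =>
    rw [cycleGraph_adj_iff hn] at h
    rw [SimpleGraph.Walk.length_cons]
    unfold CycleNear at *
    omega

theorem edist_le_of_cycleNear {n : ℕ} (hn : 2 ≤ n) {k : ℕ} {u v : Fin n} (h : CycleNear k u v) :
    (SimpleGraph.cycleGraph n).edist u v ≤ k := by
  induction k generalizing u with
  | zero =>
    have huv : u = v := by
      unfold CycleNear at h
      omega
    simp [huv]
  | succ k ih =>
    have key : CycleNear k u v ∨ ∃ w, (SimpleGraph.cycleGraph n).Adj u w ∧ CycleNear k w v := by
      simp only [cycleGraph_adj_iff hn]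
      unfold CycleNear at h ⊢
      by_cases hk : ((u : ℕ) ≤ v + k ∧ (v : ℕ) ≤ u + k) ∨ (u : ℕ) + n ≤ v + k ∨ (v : ℕ) + n ≤ u + k
      · exact Or.inl hk
      right
      -- Since `u` and `v` are not within `k`, the target lies exactly `k + 1` steps ahead or
      -- behind; `w` is one step from `u` in that direction, with wraparound.
      by_cases hup : (v : ℕ) = u + k + 1 ∨ (v : ℕ) + n = u + k + 1
      · by_cases hu : (u : ℕ) + 1 = n
        · exact ⟨⟨0, by omega⟩, by dsimp only; omega, by dsimp only; omega⟩
        · exact ⟨⟨u + 1, by omega⟩, by dsimp only; omega, by dsimp only; omega⟩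
      · by_cases hu : (u : ℕ) = 0
        · exact ⟨⟨n - 1, by omega⟩, by dsimp only; omega, by dsimp only; omega⟩
        · exact ⟨⟨u - 1, by omega⟩, by dsimp only; omega, by dsimp only; omega⟩
    rcases key with h | ⟨w, hw, hwv⟩
    · exact (ih h).trans (by exact_mod_cast Nat.le_succ k)
    · calc (SimpleGraph.cycleGraph n).edist u v
          ≤ (SimpleGraph.cycleGraph n).edist u w + (SimpleGraph.cycleGraph n).edist w v :=
            SimpleGraph.edist_triangle
        _ ≤ 1 + k := add_le_add (SimpleGraph.edist_eq_one_iff_adj.mpr hw).le (ih hwv)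
        _ = (k + 1 : ℕ) := by push_cast; rw [add_comm]

theorem cyclePower_adj_iff {n : ℕ} (hn : 2 ≤ n) (r : ℕ) (u v : Fin n) :
    (cyclePower n r).Adj u v ↔ u ≠ v ∧ CycleNear r u v := by
  refine and_congr_right fun _ => ⟨fun h => ?_, edist_le_of_cycleNear hn⟩
  obtain ⟨p, hp⟩ := SimpleGraph.exists_walk_of_edist_ne_top (ne_top_of_le_ne_top (by simp) h)
  have hpr : p.length ≤ r := by
    rw [← hp] at h
    exact_mod_cast h
  have := cycleNear_length hn p
  unfold CycleNear at *
  omega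

end CycleDistance

/-! ### Arithmetic description of the added edges. -/

section ExtendedCyclePower

/-- Stage `s` supplies the differences `2r + 2 - s` and `3r + 3 - s`, and its upper bounds on `i`
say exactly that `b ≤ 3r + 3`. Solving for `s` shows that `2r + 2` and `2r + 3` are the differences
skipped. -/
theorem firstPhase_iff (r a b : ℤ) : FirstPhase r a b ↔
    1 ≤ a ∧ b ≤ 3 * r + 3 ∧ a + r + 3 ≤ b ∧ (b ≤ a + 2 * r + 1 ∨ a + 2 * r + 4 ≤ b) := by
  constructor
  · rintro ⟨s, hs, hsr, ⟨i, hi, hi', rfl, rfl⟩ | ⟨i, hi, hi', rfl, rfl⟩⟩ <;> omega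
  · rintro ⟨ha, hb, hab, h | h⟩
    · exact ⟨2 * r + 2 - (b - a), by omega, by omega, Or.inl ⟨a, by omega, by omega, rfl, by omega⟩⟩
    · exact ⟨3 * r + 3 - (b - a), by omega, by omega, Or.inr ⟨a, by omega, by omega, rfl, by omega⟩⟩

theorem secondPhase_iff (r a b : ℤ) : SecondPhase r a b ↔
    a ≤ 0 ∧ 3 * r + 4 ≤ b ∧ b ≤ a + 4 * r + 3 := by
  constructor
  · rintro ⟨x, y, hx, hx', hy, hy', hxy, rfl, rfl⟩
    omega
  · rintro ⟨ha, hb, hab⟩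
    exact ⟨-a, b - 3 * r - 3, by omega, by omega, by omega, by omega, by omega, by omega, by omega⟩

theorem modEq_iff_eq_or_eq_add {n u a : ℤ} (hu : 0 ≤ u) (hun : u < n) (ha : -n < a) (han : a < n) :
    u ≡ a [ZMOD n] ↔ u = a ∨ u = a + n := by
  constructor
  · intro h
    have h' : u = a % n := by rw [← h, Int.emod_eq_of_lt hu hun]
    rcases le_or_gt 0 a with h0 | h0
    · exact Or.inl (by rw [h', Int.emod_eq_of_lt h0 han])
    · right
      rw [h', ← Int.add_emod_right, Int.emod_eq_of_lt (by omega) (by omega)]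
  · rintro (rfl | rfl)
    · rfl
    · simp [Int.ModEq]

/-- The bound on `n` keeps all labels strictly between `-n` and `n`; only the negative labels `a` of
the second phase wrap around, to `a + n`. -/
theorem extendedEdge_iff {n r : ℕ} (hn : 5 * r + 4 ≤ n) (u v : Fin n) :
    (∃ a b : ℤ, (FirstPhase r a b ∨ SecondPhase r a b) ∧
      ((u : ℕ) : ℤ) ≡ a [ZMOD n] ∧ ((v : ℕ) : ℤ) ≡ b [ZMOD n]) ↔
    (1 ≤ (u : ℕ) ∧ (v : ℕ) ≤ 3 * r + 3 ∧ (u : ℕ) + r + 3 ≤ v ∧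
      ((v : ℕ) ≤ u + 2 * r + 1 ∨ (u : ℕ) + 2 * r + 4 ≤ v)) ∨
    (3 * r + 4 ≤ (v : ℕ) ∧ (((u : ℕ) = 0 ∧ (v : ℕ) ≤ 4 * r + 3) ∨ (v : ℕ) + n ≤ u + 4 * r + 3)) := by
  simp only [firstPhase_iff, secondPhase_iff]
  constructor
  · rintro ⟨a, b, h, hua, hvb⟩
    rw [modEq_iff_eq_or_eq_add (by omega) (by omega) (by omega) (by omega)] at hua hvb
    omega
  · rintro (h | ⟨hv, h | h⟩)
    · exact ⟨u, v, Or.inl (by omega), rfl, rfl⟩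
    · exact ⟨u, v, Or.inr (by omega), rfl, rfl⟩
    · exact ⟨u - n, v, Or.inr (by omega), by simp [Int.ModEq], rfl⟩

end ExtendedCyclePower

/-! ### Identification with the strip model and assembly. -/

section Comparison

open StripVertex

variable {r N : ℕ}

/-- The position of a vertex of the model on the cycle with `N + (3 * r + 3)` vertices. -/
def StripVertex.label (hN : 1 ≤ N) : StripVertex r N → Fin (N + (3 * r + 3))
  | left a => ⟨a + 1, by omega⟩
  | middle b => ⟨b + r + 2, by omega⟩
  | right c => ⟨c + 2 * r + 3, by omega⟩
  -- The last outer vertex would receive the label `N + (3r + 3)`, which is `0` modulo the cycle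
  -- length.
  | outer j => if h : (j : ℕ) + 1 = N then ⟨0, by omega⟩ else ⟨j + 3 * r + 4, by omega⟩

theorem StripVertex.bijective_label (hN : 1 ≤ N) :
    Function.Bijective (label hN : StripVertex r N → Fin (N + (3 * r + 3))) := by
  constructor
  · rintro (a | a | a | a) (b | b | b | b) <;> simp only [label] <;> try split_ifs
    all_goals simp [Fin.ext_iff, -Fin.val_eq_zero_iff]
    all_goals omega
  · intro v
    by_cases h0 : (v : ℕ) = 0
    · exact ⟨outer ⟨N - 1, by omega⟩, by simp [label, Fin.ext_iff, h0]; omega⟩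
    by_cases h1 : (v : ℕ) ≤ r + 1
    · exact ⟨left ⟨v - 1, by omega⟩, by simp [label, Fin.ext_iff]; omega⟩
    by_cases h2 : (v : ℕ) ≤ 2 * r + 2
    · exact ⟨middle ⟨v - (r + 2), by omega⟩, by simp [label, Fin.ext_iff]; omega⟩
    by_cases h3 : (v : ℕ) ≤ 3 * r + 3
    · exact ⟨right ⟨v - (2 * r + 3), by omega⟩, by simp [label, Fin.ext_iff]; omega⟩
    · refine ⟨outer ⟨v - (3 * r + 4), by omega⟩, ?_⟩
      rw [label, dif_neg (by dsimp only; omega)]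
      simp [Fin.ext_iff]
      omega

theorem extendedCyclePower_adj_iff {n : ℕ} (hn : 5 * r + 4 ≤ n) (u v : Fin n) :
    (extendedCyclePower n r).Adj u v ↔ u ≠ v ∧ (CycleNear r u v ∨
      ((1 ≤ (u : ℕ) ∧ (v : ℕ) ≤ 3 * r + 3 ∧ (u : ℕ) + r + 3 ≤ v ∧
        ((v : ℕ) ≤ u + 2 * r + 1 ∨ (u : ℕ) + 2 * r + 4 ≤ v)) ∨
      (3 * r + 4 ≤ (v : ℕ) ∧
        (((u : ℕ) = 0 ∧ (v : ℕ) ≤ 4 * r + 3) ∨ (v : ℕ) + n ≤ u + 4 * r + 3))) ∨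
      ((1 ≤ (v : ℕ) ∧ (u : ℕ) ≤ 3 * r + 3 ∧ (v : ℕ) + r + 3 ≤ u ∧
        ((u : ℕ) ≤ v + 2 * r + 1 ∨ (v : ℕ) + 2 * r + 4 ≤ u)) ∨
      (3 * r + 4 ≤ (u : ℕ) ∧
        (((v : ℕ) = 0 ∧ (u : ℕ) ≤ 4 * r + 3) ∨ (u : ℕ) + n ≤ v + 4 * r + 3)))) := by
  rw [extendedCyclePower, SimpleGraph.sup_adj, SimpleGraph.fromRel_adj, extendedEdge_iff hn,
    extendedEdge_iff hn, cyclePower_adj_iff (by omega), ← and_or_left]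

theorem stripRelation_iff_not_adj (hN : 2 * r + 1 ≤ N) (u v : StripVertex r N) :
    stripRelation r N ⟨False, False, False, False, True⟩ u v ↔
      ¬ (extendedCyclePower (N + (3 * r + 3)) r).Adj (u.label (by omega)) (v.label (by omega)) := by
  rw [extendedCyclePower_adj_iff (by omega)]
  unfold CycleNear
  rcases u with a | a | a | a <;> rcases v with b | b | b | b <;>
    simp only [label, stripRelation, CycleFar] <;> try split_ifs
  all_goals
    simp only [ne_eq, Fin.ext_iff, true_or, false_or, false_and, or_false, true_and, true_iff, not_true, not_false_eq_true,
      iff_true]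
    omega

theorem cycleFar_iff_not_adj (hN : 2 ≤ N) (u v : Fin N) :
    CycleFar r N u v ↔ ¬ (cyclePower N r).Adj u v := by
  rw [cyclePower_adj_iff hN, ne_eq, Fin.ext_iff]
  unfold CycleFar CycleNear
  rw [Fin.ext_iff]
  omega

/-- The strip model has the homotopy type of the join of a cycle of length four with the
cycle power. -/
theorem homotopyEquiv_stripRelation (hr : 1 ≤ r) (hN : 2 * r + 1 ≤ N) :
    Nonempty (ContinuousMap.HomotopyEquiv
      (cliqueSpace (stripRelation r N ⟨False, False, False, False, True⟩))
      (cliqueSpace (cycleJoinRelation 4 (CycleFar r N)))) := by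
  rcases hr.eq_or_lt with rfl | hr2
  · obtain ⟨e₁⟩ := homotopyEquiv_middleOuter_one (N := N)
    obtain ⟨e₂⟩ := homotopyEquiv_leftRightOuter_one (N := N) hN
    obtain ⟨e₃⟩ := homotopyEquiv_fold_one (N := N)
    exact ⟨e₁.symm.trans (e₂.trans e₃)⟩
  -- The right-right pairs are inserted only to complete the left-outer pairs and are then
  -- withdrawn, because the right-outer exchange and the fold require them absent.
  · obtain ⟨e₁⟩ := homotopyEquiv_rightRight (N := N) hr2 False
    obtain ⟨e₂⟩ := homotopyEquiv_leftOuter hr hN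
    obtain ⟨e₃⟩ := homotopyEquiv_rightRight (N := N) hr2 True
    obtain ⟨e₄⟩ := homotopyEquiv_leftLeft (N := N) hr2
    obtain ⟨e₅⟩ := homotopyEquiv_rightOuter (N := N) hr
    obtain ⟨e₆⟩ := homotopyEquiv_fold (r := r) (N := N)
    obtain ⟨e₇⟩ := homotopyEquiv_cycleJoin (S := CycleFar r N) (fun _ _ => CycleFar.symm)
      (show 4 ≤ r + 2 by omega)
    exact ⟨(((((e₁.trans e₂).trans e₃.symm).trans e₄).trans e₅).trans e₆).trans e₇⟩

/-- The independence complex of the extended cycle power is the strip model. -/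
theorem homotopyEquiv_label (hN : 2 * r + 1 ≤ N) :
    Nonempty (ContinuousMap.HomotopyEquiv
      (cliqueSpace fun u v => ¬ (extendedCyclePower (N + (3 * r + 3)) r).Adj u v)
      (cliqueSpace (stripRelation r N ⟨False, False, False, False, True⟩))) := by
  have hN1 : 1 ≤ N := by omega
  let e := Equiv.ofBijective _ (bijective_label (r := r) hN1)
  have he : ∀ u, label hN1 (e.symm u) = u := e.apply_symm_apply
  have he' : ∀ u, e.symm (label hN1 u) = u := e.symm_apply_apply
  refine nonempty_homotopyEquiv_of_contiguous (fun u v h h' => h h'.symm) stripRelation_symm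
    e.symm (label hN1) ?_ ?_ ?_ ?_
  · intro u v h
    rwa [stripRelation_iff_not_adj hN, he, he]
  · intro u v h
    rwa [← stripRelation_iff_not_adj hN]
  · intro u v h
    rwa [he]
  · intro u v h
    rwa [he']

end Comparison

theorem mainTheorem3 (n r : ℕ) (hr : 1 ≤ r) (hn : 5 * r + 4 ≤ n) :
    Nonempty (ContinuousMap.HomotopyEquiv
      (geomRealization (independenceComplex (extendedCyclePower n r)))
      (Suspension (Suspension
        (geomRealization (independenceComplex (cyclePower (n - (3 * r + 3)) r)))))) := by
  obtain ⟨N, rfl⟩ : ∃ N, n = N + (3 * r + 3) := ⟨n - (3 * r + 3), by omega⟩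
  have hN : 2 * r + 1 ≤ N := by omega
  rw [Nat.add_sub_cancel, geomRealization_independenceComplex, geomRealization_independenceComplex]
  have hfar : (fun u v => ¬ (cyclePower N r).Adj u v) = CycleFar r N := by
    funext u v
    exact propext (cycleFar_iff_not_adj (by omega) u v).symm
  rw [hfar]
  obtain ⟨e₁⟩ := homotopyEquiv_label hN
  obtain ⟨e₂⟩ := homotopyEquiv_stripRelation hr hN
  obtain ⟨e₃⟩ := homotopyEquiv_cycleJoin_four (S := CycleFar r N) fun _ _ => CycleFar.symm
  exact ⟨(e₁.trans e₂).trans (e₃.trans ((Suspension.homeomorph (suspensionHomeomorph _)).trans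
    (suspensionHomeomorph _)).symm.toHomotopyEquiv)⟩
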